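/- For a finite simple connected graph $G$, an orientation of $G$ is a digraph obtained by assigning to each edge of $G$ exactly one of its two directions; it is strong if for any two vertices $u,v$ it contains a directed path from $u$ to $v$. For a digraph $D$, let $\partial_D(u,v)$ be the number of arcs in a shortest directed path from $u$ to $v$, and let $\operatorname{diam}(D)=\max_{u,v}\partial_D(u,v)$. The oriented diameter of $G$ is $$f(G)=\min\{\operatorname{diam}(D) : D \text{ is a strong orientation of } G\}.$$ Let $K(3,4,q)$ be the complete tripartite graph whose three parts have $3$, $4$ and $q$ vertices. Theorem. For every integer $q\ge 4$, $$f(K(3,4,q))=\begin{cases}2, & \text{if } q\le 11,\\ 3, & \text{if } q>11.\end{cases}$$ -/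

import Mathlib

namespace OrientedDiameter

/-- The complete multipartite graph `K(p₁, …, pₙ)`: the `i`-th part has `p i` vertices, and two
vertices are adjacent exactly when they lie in different parts. -/
abbrev completeMultipartite {n : ℕ} (p : Fin n → ℕ) : SimpleGraph (Σ i, Fin (p i)) :=
  SimpleGraph.completeMultipartiteGraph (fun i => Fin (p i))

/-- `D` is an orientation of `G`: it is obtained by giving every edge of `G` exactly one of its two
directions, and it has no other arcs. -/
structure IsOrientation {V : Type*} (G : SimpleGraph V) (D : Digraph V) : Prop where
  adj_of_arc : ∀ u v, D.Adj u v → G.Adj u v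
  arc_or_arc : ∀ u v, G.Adj u v → D.Adj u v ∨ D.Adj v u
  not_both : ∀ u v, ¬ (D.Adj u v ∧ D.Adj v u)

/-- `HasWalk D n u v`: there is a directed walk from `u` to `v` in `D` with exactly `n` arcs. -/
inductive HasWalk {V : Type*} (D : Digraph V) : ℕ → V → V → Prop
  | nil (u : V) : HasWalk D 0 u u
  | cons {n : ℕ} {u v w : V} : D.Adj u v → HasWalk D n v w → HasWalk D (n + 1) u w

/-- A digraph is strong if every vertex can be reached from every vertex. -/
def IsStrong {V : Type*} (D : Digraph V) : Prop :=
  ∀ u v, ∃ n, HasWalk D n u v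

/-- The directed distance from `u` to `v`: the least number of arcs of a directed walk
(equivalently, of a directed path) from `u` to `v`; it is `⊤` if there is none. -/
noncomputable def dist {V : Type*} (D : Digraph V) (u v : V) : ℕ∞ :=
  ⨅ (n : ℕ) (_ : HasWalk D n u v), (n : ℕ∞)

/-- The diameter of a digraph: the largest directed distance over all ordered pairs. -/
noncomputable def diam {V : Type*} (D : Digraph V) : ℕ∞ :=
  ⨆ (u : V) (v : V), dist D u v

/-- The oriented diameter `f(G)`: the least diameter of a strong orientation of `G`
(a minimum, because `ℕ∞` is well-ordered; it is `⊤` if `G` has no strong orientation). -/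
noncomputable def orientedDiam {V : Type*} (G : SimpleGraph V) : ℕ∞ :=
  ⨅ (D : Digraph V) (_ : IsOrientation G D ∧ IsStrong D), diam D

end OrientedDiameter

/-!
In an orientation of `K(3,4,q)` of diameter at most two, each vertex `z` of the part of size `q` is
described by its out-neighbourhood, a pair `(X, Y)` of subsets of the parts of sizes three and four.
A path of length two between two such vertices passes through the other two parts, so the pairs form
an antichain. A path of length two between `z` and a vertex `x` of the part of size three has its
middle vertex in the part of size four, so the out-neighbourhood `A` of `x` in that part satisfies
`A ⊈ Y` if `x ∈ X`, and `Y ⊈ A` if `x ∉ X`; the same holds with the roles of the two small parts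
exchanged. Thus each of the `2 ^ 12` orientations of `K(3,4)` leaves a list of admissible pairs, and
`q` is at most the width of that list. Greedy chain covers bound the width: in every case they use at
most eleven chains (`chainCoverable_admissible`), so that `q ≤ 11` by `card_le_of_chainCoverable`.
Sorting the out-neighbourhoods `A` reduces the number of cases from 4096 to 816.

Conversely, an explicit orientation of `K(3,4,11)` has diameter two with all middle vertices taken
from the two small parts and four vertices of the large one (`exists_mem_modelOut`). Deleting other
vertices of the large part keeps the diameter at two, and duplicating one of its vertices gives
diameter at most three, since every vertex lies on a directed triangle. Diameter one is impossible
because an edge is oriented in only one direction.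
-/

namespace OrientedDiameter

/-! ### Greedy chain covers -/

section ChainCover

variable {α : Type*}

/-- Run through the list once, extending greedily upwards the chain whose current top is the first
argument: an entry above the top joins the chain and becomes the new top. The value is the list of
the entries left over. -/
def peel (r : α → α → Bool) : α → List α → List α
  | _, [] => []
  | t, w :: L => bif r t w then peel r w L else w :: peel r t L

/-- Whether repeatedly peeling off greedy chains exhausts the list in at most `n` rounds. -/
def chainCoverable (r : α → α → Bool) : ℕ → List α → Bool
  | _, [] => true
  | 0, _ :: _ => false
  | n + 1, v :: L => chainCoverable r n (peel r v L)

/-- The entries that `peel` removes, together with the initial top, form a chain. The condition that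
this chain lies above `t` is what makes the induction go through. -/
theorem exists_chain_peel {r : α → α → Bool} (hrefl : ∀ v, r v v)
    (htrans : ∀ u v w, r u v → r v w → r u w) (t : α) (L : List α) :
    ∃ C : Set α, t ∈ C ∧ (∀ v ∈ C, r t v) ∧ (∀ v ∈ C, ∀ w ∈ C, r v w ∨ r w v) ∧
      ∀ v ∈ L, v ∈ C ∨ v ∈ peel r t L := by
  induction L generalizing t with
  | nil => exact ⟨{t}, by simp [hrefl]⟩
  | cons w L ih =>
    by_cases h : r t w
    · obtain ⟨C, hw, hle, hC, hL⟩ := ih w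
      have hle' : ∀ v ∈ C, r t v := fun v hv => htrans _ _ _ h (hle v hv)
      refine ⟨insert t C, by simp, by simpa [hrefl] using hle', ?_, ?_⟩
      · rintro u (rfl | hu) v (rfl | hv)
        · exact Or.inl (hrefl _)
        · exact Or.inl (hle' v hv)
        · exact Or.inr (hle' u hu)
        · exact hC u hu v hv
      · intro v hv
        simp only [peel, h, cond_true]
        rcases List.mem_cons.1 hv with rfl | hv
        · exact Or.inl (Or.inr hw)
        · exact (hL v hv).imp_left Or.inr
    · obtain ⟨C, ht, hle, hC, hL⟩ := ih t
      refine ⟨C, ht, hle, hC, fun v hv => ?_⟩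
      simp only [peel, h, cond_false, List.mem_cons]
      rcases List.mem_cons.1 hv with rfl | hv
      · exact Or.inr (Or.inl rfl)
      · exact (hL v hv).imp_right Or.inr

/-- The easy half of Dilworth's theorem: an antichain meets each chain at most once. The antichain
is given as an indexed family, so that no injectivity has to be checked separately. -/
theorem card_le_of_chainCoverable {ι : Type*} {r : α → α → Bool} (hrefl : ∀ v, r v v)
    (htrans : ∀ u v w, r u v → r v w → r u w) (f : ι → α) (n : ℕ) (L : List α)
    (hL : chainCoverable r n L) (s : Finset ι) (hs : ∀ k ∈ s, f k ∈ L)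
    (hanti : ∀ k ∈ s, ∀ l ∈ s, r (f k) (f l) → k = l) : s.card ≤ n := by
  classical
  induction n generalizing L s with
  | zero =>
    cases L with
    | nil => simpa [Finset.eq_empty_iff_forall_notMem] using hs
    | cons v L => simp [chainCoverable] at hL
  | succ n ih =>
    cases L with
    | nil =>
      have : s = ∅ := by simpa [Finset.eq_empty_iff_forall_notMem] using hs
      simp [this]
    | cons v L =>
      obtain ⟨C, hv, -, hC, hCL⟩ := exists_chain_peel hrefl htrans v L
      have h1 : (s.filter fun k => f k ∈ C).card ≤ 1 := by
        refine Finset.card_le_one.2 fun k hk l hl => ?_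
        rw [Finset.mem_filter] at hk hl
        rcases hC _ hk.2 _ hl.2 with h | h
        · exact hanti k hk.1 l hl.1 h
        · exact (hanti l hl.1 k hk.1 h).symm
      have h2 : (s.filter fun k => f k ∉ C).card ≤ n := by
        refine ih (peel r v L) hL _ (fun k hk => ?_) fun k hk l hl => ?_
        · rw [Finset.mem_filter] at hk
          rcases List.mem_cons.1 (hs k hk.1) with h | h
          · exact absurd (h ▸ hv) hk.2
          · exact (hCL _ h).resolve_left hk.2
        · exact hanti k (Finset.mem_filter.1 hk).1 l (Finset.mem_filter.1 hl).1
      have := s.card_filter_add_card_filter_not (fun k => f k ∈ C)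
      omega

end ChainCover

/-! ### Admissible out-neighbourhoods as bit masks -/

section BitMasks

/-- Inclusion of finite sets of naturals encoded as bit masks. It is phrased through `Nat.beq` and
`&&&`, on which the kernel computes with binary arithmetic. -/
def bitSubset (s t : ℕ) : Bool := Nat.beq (s &&& t) s

theorem bitSubset_ofBits {n : ℕ} (f g : Fin n → Bool) :
    bitSubset (Nat.ofBits f) (Nat.ofBits g) ↔ ∀ i, f i → g i := by
  rw [bitSubset, Nat.beq_eq]
  constructor
  · intro h i hi
    have := congrArg (Nat.testBit · i) h
    simp only [Nat.testBit_land, Nat.testBit_ofBits_lt _ _ i.isLt] at this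
    simpa [hi] using this
  · intro h
    refine Nat.eq_of_testBit_eq fun i => ?_
    by_cases hi : i < n
    · simp only [Nat.testBit_land, Nat.testBit_ofBits_lt _ _ hi]
      simpa using h ⟨i, hi⟩
    · simp [Nat.testBit_ofBits_ge _ _ (not_lt.1 hi)]

theorem bitSubset_iff {s t : ℕ} : bitSubset s t ↔ s &&& t = s := by
  rw [bitSubset, Nat.beq_eq]

/-- Componentwise inclusion of pairs of bit masks. A pair stands for the out-neighbourhood of a
vertex of the third part: its first entry lists the out-neighbours in the first part (three bits),
its second entry those in the second part (four bits). -/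
def pairSubset (v w : ℕ × ℕ) : Bool := bitSubset v.1 w.1 && bitSubset v.2 w.2

theorem pairSubset_refl (v : ℕ × ℕ) : pairSubset v v := by
  simp [pairSubset, bitSubset_iff]

theorem pairSubset_trans (u v w : ℕ × ℕ) (huv : pairSubset u v) (hvw : pairSubset v w) :
    pairSubset u w := by
  have key : ∀ a b c : ℕ, a &&& b = a → b &&& c = b → a &&& c = a := fun a b c h h' => by
    rw [← h, Nat.land_assoc, h']
  simp only [pairSubset, Bool.and_eq_true, bitSubset_iff] at *
  exact ⟨key _ _ _ huv.1 hvw.1, key _ _ _ huv.2 hvw.2⟩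

/-- Let `u` have out-neighbourhood `a` and `v` have out-neighbourhood `S` in a part containing
neither of them, and let `mem` say whether the arc between them is `v → u`. Then `detour a mem S`
says that the opposite direction is bridged by a path of length two through that part: a `w` with
`u → w → v` lies in `a` but not in `S`, and a `w` with `v → w → u` lies in `S` but not in `a`. -/
def detour (a : ℕ) (mem : Bool) (S : ℕ) : Bool :=
  bif mem then !bitSubset a S else !bitSubset S a

theorem detour_ofBits {n : ℕ} (f g : Fin n → Bool) (m : Bool) :
    detour (Nat.ofBits f) m (Nat.ofBits g) ↔
      (m = true → ∃ i, f i = true ∧ g i = false) ∧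
      (m = false → ∃ i, g i = true ∧ f i = false) := by
  have h1 := bitSubset_ofBits f g
  have h2 := bitSubset_ofBits g f
  cases m
  · simpa [detour] using (not_congr h2)
  · simpa [detour] using (not_congr h1)

/-- If `a i` is the set of out-neighbours in the second part of the `i`-th vertex of the first part,
then `column a j` is the set of out-neighbours in the first part of the `j`-th vertex of the second
part. -/
def column (a : Fin 3 → ℕ) (j : ℕ) : ℕ := Nat.ofBits fun i => !(a i).testBit j

/-- The pairs that have the required detours to and from the `i`-th vertex of the first part, whose
out-neighbourhood in the second part is `a`. -/
def filterFst (i a : ℕ) (L : List (ℕ × ℕ)) : List (ℕ × ℕ) :=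
  L.filter fun v => detour a (v.1.testBit i) v.2

/-- The pairs that have the required detours to and from the `j`-th vertex of the second part, whose
out-neighbourhood in the first part is `b`. -/
def filterSnd (j b : ℕ) (L : List (ℕ × ℕ)) : List (ℕ × ℕ) :=
  L.filter fun v => detour b (v.2.testBit j) v.1

/-- The possible out-neighbourhoods of a vertex of the third part, when the three vertices of the
first part have out-neighbourhoods `a`, `b`, `c` in the second part and the diameter is at most two.
The list is ordered lexicographically, hence compatibly with inclusion, as suits greedy chains. -/
def admissible (a b c : ℕ) : List (ℕ × ℕ) :=
  filterSnd 3 (column ![a, b, c] 3) <| filterSnd 2 (column ![a, b, c] 2) <|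
  filterSnd 1 (column ![a, b, c] 1) <| filterSnd 0 (column ![a, b, c] 0) <|
  filterFst 2 c <| filterFst 1 b <| filterFst 0 a (List.range 8 ×ˢ List.range 16)

/-- The heart of the upper bound, a finite computation over the orientations of `K(3,4)` up to
permuting the first part: the admissible pairs always split into at most eleven chains. -/
theorem chainCoverable_admissible : ∀ c < 16, ∀ b < c + 1, ∀ a < b + 1,
    chainCoverable pairSubset 11 (admissible a b c) = true := by
  decide +kernel

end BitMasks

/-! ### Distance and diameter -/

section Distance

variable {V : Type*} {D : Digraph V}

theorem dist_le_iff {u v : V} {n : ℕ} : dist D u v ≤ n ↔ ∃ m ≤ n, HasWalk D m u v := by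
  constructor
  · intro h
    by_contra! hne
    have h' : ((n + 1 : ℕ) : ℕ∞) ≤ dist D u v :=
      le_iInf₂ fun m hm => Nat.cast_le.2 (not_le.1 fun hmn => hne m hmn hm)
    have := Nat.cast_le.1 (h'.trans h)
    omega
  · rintro ⟨m, hm, hw⟩
    exact (iInf₂_le m hw).trans (Nat.cast_le.2 hm)

theorem diam_le_iff {n : ℕ} :
    diam D ≤ n ↔ ∀ u v, ∃ m ≤ n, HasWalk D m u v := by
  simp only [diam, iSup_le_iff, dist_le_iff]

theorem isStrong_of_diam_le {n : ℕ} (h : diam D ≤ n) : IsStrong D := fun u v =>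
  let ⟨m, _, hm⟩ := diam_le_iff.1 h u v
  ⟨m, hm⟩

theorem hasWalk_zero_iff {u v : V} : HasWalk D 0 u v ↔ u = v :=
  ⟨fun h => by cases h; rfl, fun h => h ▸ .nil u⟩

theorem hasWalk_succ_iff {n : ℕ} {u v : V} :
    HasWalk D (n + 1) u v ↔ ∃ w, D.Adj u w ∧ HasWalk D n w v := by
  constructor
  · rintro (_ | ⟨h, hw⟩)
    exact ⟨_, h, hw⟩
  · rintro ⟨w, h, hw⟩
    exact .cons h hw

theorem hasWalk_one_iff {u v : V} : HasWalk D 1 u v ↔ D.Adj u v := by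
  simp [hasWalk_succ_iff, hasWalk_zero_iff]

theorem hasWalk_two_iff {u v : V} : HasWalk D 2 u v ↔ ∃ w, D.Adj u w ∧ D.Adj w v := by
  simp [hasWalk_succ_iff, hasWalk_zero_iff]

theorem diam_le_two_iff :
    diam D ≤ (2 : ℕ) ↔ ∀ u v, u ≠ v → D.Adj u v ∨ ∃ w, D.Adj u w ∧ D.Adj w v := by
  rw [diam_le_iff]
  refine forall₂_congr fun u v => ?_
  rw [← hasWalk_one_iff, ← hasWalk_two_iff]
  constructor
  · rintro ⟨m, hm, hw⟩ hne
    interval_cases m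
    · exact absurd (hasWalk_zero_iff.1 hw) hne
    · exact Or.inl hw
    · exact Or.inr hw
  · intro h
    by_cases huv : u = v
    · exact ⟨0, by simp, hasWalk_zero_iff.2 huv⟩
    · rcases h huv with h | h
      · exact ⟨1, by simp, h⟩
      · exact ⟨2, le_rfl, h⟩

theorem orientedDiam_le {G : SimpleGraph V} (hD : IsOrientation G D) {n : ℕ} (h : diam D ≤ n) :
    orientedDiam G ≤ n :=
  (iInf₂_le D ⟨hD, isStrong_of_diam_le h⟩).trans h

theorem le_orientedDiam {G : SimpleGraph V} {n : ℕ}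
    (h : ∀ D : Digraph V, IsOrientation G D → ¬ diam D ≤ n) : ((n + 1 : ℕ) : ℕ∞) ≤ orientedDiam G :=
  le_iInf₂ fun D hD => by
    have := not_le.1 (h D hD.1)
    push_cast
    exact Order.add_one_le_of_lt this

theorem IsOrientation.not_diam_le_one {G : SimpleGraph V} (hD : IsOrientation G D) {u v : V}
    (huv : G.Adj u v) : ¬ diam D ≤ (1 : ℕ) := by
  have key : ∀ u v, G.Adj u v → diam D ≤ (1 : ℕ) → D.Adj u v := by
    intro u v huv h
    obtain ⟨m, hm, hw⟩ := diam_le_iff.1 h u v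
    interval_cases m
    · exact absurd (hasWalk_zero_iff.1 hw) huv.ne
    · exact hasWalk_one_iff.1 hw
  exact fun h => hD.not_both u v ⟨key u v huv h, key v u huv.symm h⟩

end Distance

/-! ### No orientation of diameter two when the third part has more than eleven vertices -/

section UpperBound

variable {q : ℕ} {D : Digraph (Σ i, Fin (![3, 4, q] i))}

theorem IsOrientation.not_adj_iff {V : Type*} {G : SimpleGraph V} {D : Digraph V}
    (hD : IsOrientation G D) {u v : V} (h : G.Adj u v) : ¬ D.Adj u v ↔ D.Adj v u :=
  ⟨(hD.arc_or_arc u v h).resolve_left, fun h1 h2 => hD.not_both u v ⟨h2, h1⟩⟩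

/-- In diameter two every arc lies on a directed triangle. -/
theorem IsOrientation.exists_detour {V : Type*} {G : SimpleGraph V} {D : Digraph V}
    (hD : IsOrientation G D) (hdiam : diam D ≤ (2 : ℕ)) {u v : V} (h : D.Adj u v) :
    ∃ w, D.Adj v w ∧ D.Adj w u :=
  (diam_le_two_iff.1 hdiam v u (hD.adj_of_arc u v h).ne').resolve_left
    fun h' => hD.not_both u v ⟨h, h'⟩

/-- In a complete tripartite graph the third vertex of such a triangle lies in the third part. -/
theorem IsOrientation.exists_detour_third {ι : Type*} {P : ι → Type*}
    {D : Digraph (Σ i, P i)}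
    (hD : IsOrientation (SimpleGraph.completeMultipartiteGraph P) D) (hdiam : diam D ≤ (2 : ℕ))
    {i j k : ι} (hijk : ∀ l, l = i ∨ l = j ∨ l = k) {u : P i} {v : P j}
    (h : D.Adj ⟨i, u⟩ ⟨j, v⟩) : ∃ w : P k, D.Adj ⟨j, v⟩ ⟨k, w⟩ ∧ D.Adj ⟨k, w⟩ ⟨i, u⟩ := by
  obtain ⟨⟨l, w⟩, h1, h2⟩ := hD.exists_detour hdiam h
  rcases hijk l with rfl | rfl | rfl
  · exact absurd rfl (hD.adj_of_arc ⟨l, w⟩ ⟨l, u⟩ h2)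
  · exact absurd rfl (hD.adj_of_arc ⟨l, v⟩ ⟨l, w⟩ h1)
  · exact ⟨w, h1, h2⟩

/-- The bit mask form of the existence of detours, for a vertex `u` of part `i`, a vertex `v` of
part `k`, and an enumeration `w` of the remaining part `j`. -/
theorem detour_of_adj {ι : Type*} {P : ι → Type*} {D : Digraph (Σ i, P i)}
    (hD : IsOrientation (SimpleGraph.completeMultipartiteGraph P) D) (hdiam : diam D ≤ (2 : ℕ))
    {i j k : ι} (hij : i ≠ j) (hik : i ≠ k) (hjk : j ≠ k) (hijk : ∀ l, l = i ∨ l = j ∨ l = k)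
    {n : ℕ} (w : Fin n → P j) (hw : w.Surjective) (u : P i) (v : P k)
    (f g : Fin n → Bool) (m : Bool)
    (hf : ∀ a, f a ↔ D.Adj ⟨i, u⟩ ⟨j, w a⟩) (hg : ∀ a, g a ↔ D.Adj ⟨k, v⟩ ⟨j, w a⟩)
    (hm : m ↔ D.Adj ⟨k, v⟩ ⟨i, u⟩) :
    detour (Nat.ofBits f) m (Nat.ofBits g) := by
  refine (detour_ofBits f g m).2 ⟨fun h => ?_, fun h => ?_⟩
  · obtain ⟨b, h1, h2⟩ := hD.exists_detour_third hdiam (k := j)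
      (fun l => by rcases hijk l with h | h | h <;> simp [h]) (hm.1 h)
    obtain ⟨a, rfl⟩ := hw b
    refine ⟨a, (hf a).2 h1, ?_⟩
    rw [← Bool.not_eq_true, hg, hD.not_adj_iff (by simpa using hjk.symm)]
    exact h2
  · have : D.Adj ⟨i, u⟩ ⟨k, v⟩ := by
      rw [← hD.not_adj_iff (by simpa using hik.symm), ← hm, h]
      simp
    obtain ⟨b, h1, h2⟩ := hD.exists_detour_third hdiam (k := j)
      (fun l => by rcases hijk l with h | h | h <;> simp [h]) this
    obtain ⟨a, rfl⟩ := hw b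
    refine ⟨a, (hg a).2 h1, ?_⟩
    rw [← Bool.not_eq_true, hf, hD.not_adj_iff (by simpa using hij)]
    exact h2

theorem mem_admissible {a b c : ℕ} {v : ℕ × ℕ} (h1 : v.1 < 8) (h2 : v.2 < 16)
    (hfst : ∀ i : Fin 3, detour (![a, b, c] i) (v.1.testBit i) v.2)
    (hsnd : ∀ j : Fin 4, detour (column ![a, b, c] j) (v.2.testBit j) v.1) :
    v ∈ admissible a b c := by
  simp only [admissible, filterFst, filterSnd, List.mem_filter]
  exact ⟨⟨⟨⟨⟨⟨⟨List.mem_product.2 ⟨List.mem_range.2 h1, List.mem_range.2 h2⟩, hfst 0⟩,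
    hfst 1⟩, hfst 2⟩, hsnd 0⟩, hsnd 1⟩, hsnd 2⟩, hsnd 3⟩

theorem le_eleven_of_mem_admissible {a b c : ℕ} (hab : a ≤ b) (hbc : b ≤ c) (hc : c < 16)
    (f : Fin q → ℕ × ℕ) (hf : ∀ k, f k ∈ admissible a b c)
    (hanti : ∀ k l, pairSubset (f k) (f l) → k = l) : q ≤ 11 := by
  have h := chainCoverable_admissible c hc b (Nat.lt_succ_of_le hbc) a (Nat.lt_succ_of_le hab)
  simpa using card_le_of_chainCoverable pairSubset_refl pairSubset_trans f 11 _ h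
    Finset.univ (fun k _ => hf k) fun k _ l _ => hanti k l

/-- The out-neighbourhoods of the vertices of the third part form an antichain of admissible pairs. -/
theorem le_eleven_of_diam_le_two (hD : IsOrientation (completeMultipartite ![3, 4, q]) D)
    (hdiam : diam D ≤ (2 : ℕ)) : q ≤ 11 := by
  classical
  let P : Fin 3 → Type := fun i => Fin (![3, 4, q] i)
  let y : Fin 4 → P 1 := id
  let z : Fin q → P 2 := id
  -- Number the first part by increasing out-neighbourhood mask, as `chainCoverable_admissible` asks.
  obtain ⟨σ, hσ⟩ : ∃ σ : Equiv.Perm (Fin 3), Monotone fun i => Nat.ofBits fun j =>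
      decide (D.Adj ⟨0, σ i⟩ ⟨1, y j⟩) :=
    ⟨_, Tuple.monotone_sort fun i : Fin 3 => Nat.ofBits fun j => decide (D.Adj ⟨0, i⟩ ⟨1, y j⟩)⟩
  let x : Fin 3 → P 0 := σ
  let a : Fin 3 → ℕ := fun i => Nat.ofBits fun j => decide (D.Adj ⟨0, x i⟩ ⟨1, y j⟩)
  have ha : ∀ i, a i < 16 := fun i => Nat.ofBits_lt_two_pow _
  have hcol : ∀ j : Fin 4, column a j =
      Nat.ofBits fun i => decide (D.Adj ⟨1, y j⟩ ⟨0, x i⟩) := by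
    intro j
    refine congrArg Nat.ofBits (funext fun i => ?_)
    have h : (a i).testBit j = decide (D.Adj ⟨0, x i⟩ ⟨1, y j⟩) :=
      Nat.testBit_ofBits_lt _ _ j.isLt
    rw [h, Bool.eq_iff_iff, decide_eq_true_iff, ← hD.not_adj_iff (by simp)]
    simp
  have haeta : ![a 0, a 1, a 2] = a := by
    funext i
    fin_cases i <;> rfl
  let X : Fin q → Fin 3 → Bool := fun k i => decide (D.Adj ⟨2, z k⟩ ⟨0, x i⟩)
  let Y : Fin q → Fin 4 → Bool := fun k j => decide (D.Adj ⟨2, z k⟩ ⟨1, y j⟩)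
  let f : Fin q → ℕ × ℕ := fun k => (Nat.ofBits (X k), Nat.ofBits (Y k))
  have hmem : ∀ k, f k ∈ admissible (a 0) (a 1) (a 2) := by
    intro k
    refine mem_admissible (Nat.ofBits_lt_two_pow (X k)) (Nat.ofBits_lt_two_pow (Y k))
      (fun i => ?_) fun j => ?_
    · have hbit : (f k).1.testBit i = X k i := Nat.testBit_ofBits_lt (X k) i i.isLt
      rw [haeta, hbit]
      exact detour_of_adj (P := P) hD hdiam (i := 0) (j := 1) (k := 2) (by simp) (by simp)
        (by simp) (by decide) y Function.surjective_id (x i) (z k) _ (Y k) _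
        (fun _ => decide_eq_true_iff) (fun _ => decide_eq_true_iff) decide_eq_true_iff
    · have hbit : (f k).2.testBit j = Y k j := Nat.testBit_ofBits_lt (Y k) j j.isLt
      rw [haeta, hbit, hcol]
      exact detour_of_adj (P := P) hD hdiam (i := 1) (j := 0) (k := 2) (by simp) (by simp)
        (by simp) (by decide) x σ.surjective (y j) (z k) _ (X k) _
        (fun _ => decide_eq_true_iff) (fun _ => decide_eq_true_iff) decide_eq_true_iff
  -- A path of length two from `z k` to `z l` passes through a vertex of the first two parts which is
  -- an out-neighbour of `z k` but not of `z l`.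
  have hanti : ∀ k l, pairSubset (f k) (f l) → k = l := by
    intro k l h
    by_contra hkl
    simp only [f, X, Y, pairSubset, Bool.and_eq_true, bitSubset_ofBits, decide_eq_true_iff] at h
    have hne : (⟨2, z k⟩ : Σ i, P i) ≠ ⟨2, z l⟩ := fun h =>
      hkl (eq_of_heq (Sigma.mk.inj h).2)
    rcases diam_le_two_iff.1 hdiam _ _ hne with h' | ⟨⟨i, w⟩, h1, h2⟩
    · exact hD.adj_of_arc _ _ h' rfl
    · have hi := hD.adj_of_arc _ _ h1
      refine hD.not_both _ _ ⟨?_, h2⟩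
      fin_cases i
      · obtain ⟨w, rfl⟩ := σ.surjective w
        exact h.1 w h1
      · exact h.2 w h1
      · exact absurd rfl hi
  have h01 : a 0 ≤ a 1 := hσ (by decide : (0 : Fin 3) ≤ 1)
  have h12 : a 1 ≤ a 2 := hσ (by decide : (1 : Fin 3) ≤ 2)
  exact le_eleven_of_mem_admissible h01 h12 (ha 2) f hmem hanti

end UpperBound

/-! ### Orientations pulled back from an eighteen-vertex model -/

section Construction

/-- Out-neighbourhoods in an orientation of `K(3,4,11)` of diameter two, with parts `{0, 1, 2}`,
`{3, …, 6}` and `{7, …, 17}`. The arcs between the first two parts form a configuration for which the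
bound eleven on antichains of admissible pairs is attained, and `7, …, 17` realize such an
antichain. -/
def modelOut : Fin 18 → List (Fin 18) :=
  ![[7, 8, 9, 10, 11, 12, 13, 14, 15, 16, 17],
    [3, 4, 5, 7, 13, 14],
    [3, 4, 6, 7, 11, 12],
    [0, 9, 10, 12, 14, 16],
    [0, 8, 10, 11, 13, 17],
    [0, 2, 9, 15, 17],
    [0, 1, 8, 15, 16],
    [3, 4, 5, 6],
    [1, 2, 3, 5],
    [1, 2, 4, 6],
    [1, 2, 5, 6],
    [1, 3, 5, 6],
    [1, 4, 5, 6],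
    [2, 3, 5, 6],
    [2, 4, 5, 6],
    [1, 2, 3, 4],
    [1, 2, 4, 5],
    [1, 2, 3, 6]]

/-- The part of the model to which a vertex belongs. -/
def modelPart (u : Fin 18) : Fin 3 := if u < 3 then 0 else if u < 7 then 1 else 2

theorem modelPart_ne_of_mem : ∀ u, ∀ v ∈ modelOut u, modelPart u ≠ modelPart v := by
  decide +kernel

theorem mem_modelOut_or_mem : ∀ u v, modelPart u ≠ modelPart v →
    v ∈ modelOut u ∨ u ∈ modelOut v := by
  decide +kernel

theorem not_mem_modelOut_and_mem : ∀ u v, ¬ (v ∈ modelOut u ∧ u ∈ modelOut v) := by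
  decide +kernel

/-- Distances in the model are at most two, and the middle vertex can be taken among the first two
parts and the first four vertices of the third; these survive when the third part is shortened to
`q ≥ 4` vertices. -/
theorem exists_mem_modelOut : ∀ u v, u ≠ v →
    v ∈ modelOut u ∨ ∃ w < 11, w ∈ modelOut u ∧ v ∈ modelOut w := by
  decide +kernel

theorem exists_triangle_modelOut : ∀ u, ∃ v < 11, ∃ w < 11,
    v ∈ modelOut u ∧ w ∈ modelOut v ∧ u ∈ modelOut w := by
  decide +kernel

variable (q : ℕ)

/-- The part-preserving map from `K(3,4,q)` to the model. It truncates the third part at the index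
`10`, so that for `q > 11` all vertices from the eleventh on are copies of the last one; the
truncation does nothing on the first two parts. -/
def toModel (u : Σ i, Fin (![3, 4, q] i)) : Fin 18 :=
  ⟨![0, 3, 7] u.1 + min u.2.1 10, by
    obtain ⟨i, a⟩ := u
    fin_cases i <;> simp <;> omega⟩

theorem modelPart_toModel (u : Σ i, Fin (![3, 4, q] i)) : modelPart (toModel q u) = u.1 := by
  obtain ⟨i, a⟩ := u
  fin_cases i <;> have := a.isLt <;>
    simp [modelPart, toModel, Fin.lt_def] at this ⊢ <;> omega

theorem toModel_injective (hq : q ≤ 11) : Function.Injective (toModel q) := by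
  intro u v h
  have hp : u.1 = v.1 := by rw [← modelPart_toModel, h, modelPart_toModel]
  obtain ⟨i, a⟩ := u
  obtain ⟨j, b⟩ := v
  obtain rfl : i = j := hp
  have ha : a.1 < 11 ∧ b.1 < 11 := by
    have := a.isLt
    have := b.isLt
    fin_cases i <;> simp at * <;> omega
  have h : ![0, 3, 7] i + min a.1 10 = ![0, 3, 7] i + min b.1 10 := congrArg Fin.val h
  rw [Fin.ext (by omega : a.1 = b.1)]

theorem exists_toModel_eq (hq : 4 ≤ q) (w : Fin 18) (hw : w < 11) : ∃ u, toModel q u = w := by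
  have hw : w.1 < 11 := hw
  by_cases h3 : w.1 < 3
  · exact ⟨⟨0, (⟨w, h3⟩ : Fin 3)⟩, Fin.ext (by simp [toModel]; omega)⟩
  by_cases h7 : w.1 < 7
  · exact ⟨⟨1, (⟨w - 3, by omega⟩ : Fin 4)⟩, Fin.ext (by simp [toModel]; omega)⟩
  · exact ⟨⟨2, (⟨w - 7, by omega⟩ : Fin q)⟩, Fin.ext (by simp [toModel]; omega)⟩

/-- The orientation of `K(3,4,q)` in which arcs follow those of the model along `toModel`. -/
def pullback : Digraph (Σ i, Fin (![3, 4, q] i)) where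
  Adj u v := toModel q v ∈ modelOut (toModel q u)

theorem isOrientation_pullback :
    IsOrientation (completeMultipartite ![3, 4, q]) (pullback q) where
  adj_of_arc u v h := by
    have := modelPart_ne_of_mem _ _ h
    rwa [modelPart_toModel, modelPart_toModel] at this
  arc_or_arc u v h := mem_modelOut_or_mem _ _ (by rwa [modelPart_toModel, modelPart_toModel])
  not_both u v := not_mem_modelOut_and_mem _ _

theorem pullback_adj_or_exists (hq : 4 ≤ q) {u v : Σ i, Fin (![3, 4, q] i)}
    (h : toModel q u ≠ toModel q v) :
    (pullback q).Adj u v ∨ ∃ w, (pullback q).Adj u w ∧ (pullback q).Adj w v := by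
  refine (exists_mem_modelOut _ _ h).imp_right ?_
  rintro ⟨w, hw, h1, h2⟩
  obtain ⟨w, rfl⟩ := exists_toModel_eq q hq w hw
  exact ⟨w, h1, h2⟩

theorem diam_pullback_le_two (hq : 4 ≤ q) (hq' : q ≤ 11) : diam (pullback q) ≤ (2 : ℕ) :=
  diam_le_two_iff.2 fun _ _ h => pullback_adj_or_exists q hq ((toModel_injective q hq').ne h)

/-- Two vertices with the same image are joined by unrolling a directed triangle of the model through
that image. -/
theorem diam_pullback_le_three (hq : 4 ≤ q) : diam (pullback q) ≤ (3 : ℕ) := by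
  refine diam_le_iff.2 fun u v => ?_
  by_cases h : toModel q u = toModel q v
  · obtain ⟨s, hs, t, ht, h1, h2, h3⟩ := exists_triangle_modelOut (toModel q u)
    obtain ⟨s, rfl⟩ := exists_toModel_eq q hq s hs
    obtain ⟨t, rfl⟩ := exists_toModel_eq q hq t ht
    rw [h] at h3
    exact ⟨3, le_rfl, hasWalk_succ_iff.2 ⟨s, h1, hasWalk_two_iff.2 ⟨t, h2, h3⟩⟩⟩
  · rcases pullback_adj_or_exists q hq h with h | h
    · exact ⟨1, by simp, hasWalk_one_iff.2 h⟩
    · exact ⟨2, by simp, hasWalk_two_iff.2 h⟩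

end Construction
end OrientedDiameter

theorem theorem4p1 (q : ℕ) (hq : 4 ≤ q) :
    OrientedDiameter.orientedDiam (OrientedDiameter.completeMultipartite ![3, 4, q]) =
      if q ≤ 11 then 2 else 3 := by
  have hD := OrientedDiameter.isOrientation_pullback q
  split_ifs with h
  · refine le_antisymm
      (OrientedDiameter.orientedDiam_le hD (OrientedDiameter.diam_pullback_le_two q hq h)) ?_
    refine OrientedDiameter.le_orientedDiam (n := 1) fun D hD => ?_
    exact hD.not_diam_le_one (u := ⟨0, (0 : Fin 3)⟩) (v := ⟨1, (0 : Fin 4)⟩) (by simp)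
  · refine le_antisymm
      (OrientedDiameter.orientedDiam_le hD (OrientedDiameter.diam_pullback_le_three q hq)) ?_
    exact OrientedDiameter.le_orientedDiam (n := 2) fun D hD hdiam =>
      h (OrientedDiameter.le_eleven_of_diam_le_two hD hdiam)
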